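/- Let $\alpha,\beta\in\mathbb C\setminus\{0\}$ with $\alpha\neq\beta$ and $|\alpha|=|\beta|\neq 1$, and let $H_{\alpha,\beta}=(\mathbb C^2\setminus\{0\})/\langle\gamma\rangle$, $\gamma(z_1,z_2)=(\alpha z_1,\beta z_2)$, be the corresponding diagonal Hopf surface. A Hermitian metric $g$ with fundamental form $\omega$ is called Vaisman if there is a closed $1$-form $\theta$ (the Lee form) with $d\omega=\theta\wedge\omega$ which is parallel for the Levi-Civita connection of $g$. For $N\le\infty$ and $\lambda\in\mathbb C\setminus\{0\}$ with $|\lambda|\ne1$, let $H^N_\lambda=(\mathbb C^N\setminus\{0\})/\langle\lambda\cdot\mathrm{id}\rangle$ be the classical Hopf manifold (with $\ell^2(\mathbb C)$ in place of $\mathbb C^N$ if $N=\infty$), with the metric $\omega_H=\|z\|^{-2}\omega_0$, where $\omega_0=dd^c\|z\|^2$ is the form of the flat metric and $dd^c=\frac{\sqrt{-1}}{2}\partial\bar\partial$. A Hermitian metric $\omega$ on a complex manifold $M$ is called Hopf-induced if there are such $N$ and $\lambda$ and a holomorphic map $f\colon M\to H^N_\lambda$ with $f^*\omega_H=\omega$.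 Then the following hold. 1. The Gauduchon--Ornea metric on $H_{\alpha,\beta}$, that is, the metric whose pull-back to $\mathbb C^2\setminus\{0\}$ has fundamental form $\Phi^{-1}dd^c\Phi$, where $\Phi>0$ is the solution of $$|z_1|^2\,\Phi^{-\frac{2\log|\alpha|}{\log|\alpha|+\log|\beta|}}+|z_2|^2\,\Phi^{-\frac{2\log|\beta|}{\log|\alpha|+\log|\beta|}}=1,$$ exists and is a Vaisman metric. 2. No Vaisman metric on $H_{\alpha,\beta}$ (in particular, not the Gauduchon--Ornea metric) can be approximated by Hopf-induced metrics: for every $k\in\{0,1,2,\dots,\infty\}$, no sequence of Hopf-induced metrics on $H_{\alpha,\beta}$ converges to it in the $\mathcal C^k$-topology. In particular, it is not true in general that Vaisman metrics can be approximated by Hopf-induced metrics, so the analogue for locally conformally Kähler metrics of Tian's approximation theorem fails. -/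

import Mathlib

open scoped ContDiff

set_option maxSynthPendingDepth 3

noncomputable section

namespace HopfLcK

/-! ### Linear Hopf manifolds -/

section Hopf

variable {E : Type*} [NormedAddCommGroup E] [NormedSpace ℂ E]

/-- The orbit relation on `E \ {0}` of the infinite cyclic group generated by the linear
automorphism `A`. -/
def hopfSetoid (A : E ≃L[ℂ] E) : Setoid {z : E // z ≠ 0} where
  r z w := ∃ n : ℤ, (A ^ n) (z : E) = w
  iseqv :=
    { refl := fun _ => ⟨0, by rw [zpow_zero]; rfl⟩
      symm := by
        rintro z w ⟨n, hn⟩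
        refine ⟨-n, ?_⟩
        have h : (A ^ (-n) * A ^ n) (z : E) = z := by
          rw [← zpow_add, neg_add_cancel, zpow_zero]; rfl
        rw [← hn]; exact h
      trans := by
        rintro z w v ⟨n, hn⟩ ⟨m, hm⟩
        refine ⟨m + n, ?_⟩
        rw [zpow_add, ← hm, ← hn]; rfl }

/-- The linear Hopf manifold `(E \ {0}) / ⟨A⟩`. -/
def HopfManifold (A : E ≃L[ℂ] E) : Type _ := Quotient (hopfSetoid A)

/-- The covering projection `E \ {0} → (E \ {0}) / ⟨A⟩`. -/
def HopfManifold.proj (A : E ≃L[ℂ] E) (z : E) (hz : z ≠ 0) : HopfManifold A :=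
  Quotient.mk (hopfSetoid A) ⟨z, hz⟩

/-- The automorphism `λ · id`. -/
def scalarAut (E : Type*) [NormedAddCommGroup E] [NormedSpace ℂ E] (lam : ℂˣ) : E ≃L[ℂ] E :=
  ContinuousLinearEquiv.smulLeft lam

/-- A (smooth) Hermitian metric on `(E \ {0}) / ⟨A⟩`, given as the Riemannian metric
`z ↦ toFun z` on the covering `E \ {0}`, compatible with multiplication by `i` and invariant
under the deck transformation `A` (whose differential is `A`). The value at `z = 0` is
irrelevant. -/
structure HermitianMetric (A : E ≃L[ℂ] E) where
  toFun : E → E →L[ℝ] E →L[ℝ] ℝ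
  smooth : ContDiffOn ℝ ∞ toFun {0}ᶜ
  symm : ∀ z, z ≠ 0 → ∀ X Y : E, toFun z X Y = toFun z Y X
  pos : ∀ z, z ≠ 0 → ∀ X : E, X ≠ 0 → 0 < toFun z X X
  map_I : ∀ z, z ≠ 0 → ∀ X Y : E, toFun z (Complex.I • X) (Complex.I • Y) = toFun z X Y
  invariant : ∀ z, z ≠ 0 → ∀ X Y : E, toFun (A z) (A X) (A Y) = toFun z X Y

/-! ### lcK and Vaisman metrics -/

/-- The fundamental form `ω(X, Y) = g(iX, Y)`, as a function of the point. -/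
def fundForm {A : E ≃L[ℂ] E} (g : HermitianMetric A) (X Y : E) (z : E) : ℝ :=
  g.toFun z (Complex.I • X) Y

/-- `θ` is the Lee form of `g`: a smooth closed 1-form on `(E \ {0}) / ⟨A⟩` (given by its
pull-back to `E \ {0}`) with `dω = θ ∧ ω`. -/
structure IsLeeForm {A : E ≃L[ℂ] E} (g : HermitianMetric A) (θ : E → E →L[ℝ] ℝ) : Prop where
  smooth : ContDiffOn ℝ ∞ θ {0}ᶜ
  invariant : ∀ z, z ≠ 0 → ∀ X : E, θ (A z) (A X) = θ z X
  closed : ∀ z, z ≠ 0 → ∀ X Y : E, fderiv ℝ θ z X Y - fderiv ℝ θ z Y X = 0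
  lck : ∀ z, z ≠ 0 → ∀ X Y Z : E,
    fderiv ℝ (fundForm g Y Z) z X - fderiv ℝ (fundForm g X Z) z Y
        + fderiv ℝ (fundForm g X Y) z Z
      = θ z X * fundForm g Y Z z - θ z Y * fundForm g X Z z + θ z Z * fundForm g X Y z

/-- `V` is the value at `z` of `∇_X Y`, for the Levi-Civita connection `∇` of `g` and the
constant vector fields `X`, `Y` (Koszul formula). -/
def IsLeviCivita {A : E ≃L[ℂ] E} (g : HermitianMetric A) (z X Y V : E) : Prop :=
  ∀ Z : E, 2 * g.toFun z V Z =
    fderiv ℝ g.toFun z X Y Z + fderiv ℝ g.toFun z Y X Z - fderiv ℝ g.toFun z Z X Y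

/-- The 1-form `θ` is parallel for the Levi-Civita connection:
`(∇_X θ)(Y) = X(θ(Y)) - θ(∇_X Y) = 0`. -/
def IsParallel {A : E ≃L[ℂ] E} (g : HermitianMetric A) (θ : E → E →L[ℝ] ℝ) : Prop :=
  ∀ z, z ≠ 0 → ∀ X Y : E, ∃ V : E, IsLeviCivita g z X Y V ∧ fderiv ℝ θ z X Y - θ z V = 0

/-- A Vaisman metric: an lcK metric whose Lee form is parallel. -/
def IsVaisman {A : E ≃L[ℂ] E} (g : HermitianMetric A) : Prop :=
  ∃ θ : E → E →L[ℝ] ℝ, IsLeeForm g θ ∧ IsParallel g θ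

/-! ### Convergence of metrics -/

/-- `g m → g` in the `C^k`-topology (`k ≤ ∞`): on each compact subset of the covering, the
derivatives of order at most `k` of the coefficients converge uniformly. -/
def TendstoCk {A : E ≃L[ℂ] E} (k : ℕ∞) (gs : ℕ → HermitianMetric A) (g : HermitianMetric A) :
    Prop :=
  ∀ j : ℕ, (j : ℕ∞) ≤ k → ∀ K : Set E, IsCompact K → K ⊆ {0}ᶜ →
    TendstoUniformlyOn (fun m => iteratedFDeriv ℝ j (gs m).toFun)
      (iteratedFDeriv ℝ j g.toFun) Filter.atTop K

/-! ### Holomorphic maps and pull-back of metrics -/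

variable {V : Type*} [NormedAddCommGroup V] [NormedSpace ℂ V]

/-- `F` is a holomorphic local lift of `f`, on the open subset `U` of `E \ {0}`. -/
structure IsLocalLift {A : E ≃L[ℂ] E} {B : V ≃L[ℂ] V} (f : HopfManifold A → HopfManifold B)
    (U : Set E) (F : E → V) : Prop where
  isOpen : IsOpen U
  differentiableOn : DifferentiableOn ℂ F U
  lift : ∀ z ∈ U, ∃ (hz : z ≠ 0) (hF : F z ≠ 0),
    f (HopfManifold.proj A z hz) = HopfManifold.proj B (F z) hF

/-- `f` is holomorphic for the quotient complex structures. -/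
def IsHolomorphic {A : E ≃L[ℂ] E} {B : V ≃L[ℂ] V} (f : HopfManifold A → HopfManifold B) : Prop :=
  ∀ z : E, z ≠ 0 → ∃ (U : Set E) (F : E → V), z ∈ U ∧ IsLocalLift f U F

/-- `f^* h = g`. -/
def IsPullback {A : E ≃L[ℂ] E} {B : V ≃L[ℂ] V} (f : HopfManifold A → HopfManifold B)
    (h : HermitianMetric B) (g : HermitianMetric A) : Prop :=
  ∀ (U : Set E) (F : E → V), IsLocalLift f U F → ∀ z ∈ U, ∀ X Y : E,
    g.toFun z X Y = h.toFun (F z) (fderiv ℂ F z X) (fderiv ℂ F z Y)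

end Hopf

/-! ### Classical Hopf manifolds and Hopf-induced metrics -/

section Classical

/-- The flat metric `g₀(X, Y) = Re ⟪X, Y⟫` of a complex inner product space. -/
def flatMetric (V : Type*) [NormedAddCommGroup V] [InnerProductSpace ℂ V] : V →L[ℝ] V →L[ℝ] ℝ :=
  LinearMap.mkContinuous₂
    (LinearMap.mk₂ ℝ (fun X Y : V => (inner ℂ X Y).re)
      (fun X X' Y => by simp)
      (fun c X Y => by
        rw [← Complex.coe_smul, inner_smul_left]; simp)
      (fun X Y Y' => by simp)
      (fun c X Y => by
        rw [← Complex.coe_smul, inner_smul_right]; simp))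
    1
    (fun X Y => by
      simpa using (Complex.abs_re_le_norm _).trans (norm_inner_le_norm (𝕜 := ℂ) X Y))

theorem flatMetric_apply {V : Type*} [NormedAddCommGroup V] [InnerProductSpace ℂ V] (X Y : V) :
    flatMetric V X Y = (inner ℂ X Y).re := rfl

/-- The metric `‖z‖⁻² g₀` on the classical Hopf manifold `(V \ {0}) / ⟨λ · id⟩`. -/
def classicalHopfMetric (V : Type*) [NormedAddCommGroup V] [InnerProductSpace ℂ V] (lam : ℂˣ) :
    HermitianMetric (scalarAut V lam) where
  toFun z := (‖z‖ ^ 2)⁻¹ • flatMetric V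
  smooth := by
    have h1 : ContDiffOn ℝ ∞ (fun z : V => ‖z‖ ^ 2) {0}ᶜ := by
      let _ : InnerProductSpace ℝ V := InnerProductSpace.rclikeToReal ℂ V
      exact (contDiff_norm_sq ℝ (E := V) (n := ∞)).contDiffOn
    have h2 : ContDiffOn ℝ ∞ (fun z : V => (‖z‖ ^ 2)⁻¹) {0}ᶜ := by
      refine h1.inv fun z hz => ?_
      have : z ≠ 0 := hz
      simpa using this
    exact h2.smul contDiffOn_const
  symm z _ X Y := by
    change (‖z‖ ^ 2)⁻¹ * (inner ℂ X Y).re = (‖z‖ ^ 2)⁻¹ * (inner ℂ Y X).re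
    rw [← inner_conj_symm X Y, Complex.conj_re]
  pos z hz X hX := by
    change 0 < (‖z‖ ^ 2)⁻¹ * (inner ℂ X X).re
    have h2 : (inner ℂ X X).re = ‖X‖ ^ 2 := by
      rw [inner_self_eq_norm_sq_to_K]; norm_cast
    rw [h2]
    positivity
  map_I z _ X Y := by
    change (‖z‖ ^ 2)⁻¹ * (inner ℂ (Complex.I • X) (Complex.I • Y)).re
      = (‖z‖ ^ 2)⁻¹ * (inner ℂ X Y).re
    simp [← mul_assoc]
  invariant z hz X Y := by
    have hl : ‖(lam : ℂ)‖ ≠ 0 := by simp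
    have hz' : ‖z‖ ≠ 0 := by simpa using hz
    change (‖(lam : ℂ) • z‖ ^ 2)⁻¹ * (inner ℂ ((lam : ℂ) • X) ((lam : ℂ) • Y)).re
      = (‖z‖ ^ 2)⁻¹ * (inner ℂ X Y).re
    have hin : (inner ℂ ((lam : ℂ) • X) ((lam : ℂ) • Y)).re
        = ‖(lam : ℂ)‖ ^ 2 * (inner ℂ X Y).re := by
      rw [inner_smul_left, inner_smul_right, ← mul_assoc, Complex.conj_mul', ← Complex.ofReal_pow,
        Complex.re_ofReal_mul]
    rw [hin, norm_smul]
    field_simp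

/-- The Hermitian metric `g` is induced by a holomorphic map into the classical Hopf manifold
`(V \ {0}) / ⟨λ · id⟩`. -/
def IsInducedBy {E : Type*} [NormedAddCommGroup E] [NormedSpace ℂ E] {A : E ≃L[ℂ] E}
    (V : Type*) [NormedAddCommGroup V] [InnerProductSpace ℂ V] (lam : ℂˣ)
    (g : HermitianMetric A) : Prop :=
  ∃ f : HopfManifold A → HopfManifold (scalarAut V lam),
    IsHolomorphic f ∧ IsPullback f (classicalHopfMetric V lam) g

/-- Hopf-induced metrics: those induced by a holomorphic map into an `N`-dimensional classical
Hopf manifold, where `N ≤ ∞` and the model space for `N = ∞` is `ℓ²(ℂ)`. -/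
def IsHopfInduced {E : Type*} [NormedAddCommGroup E] [NormedSpace ℂ E] {A : E ≃L[ℂ] E}
    (g : HermitianMetric A) : Prop :=
  ∃ lam : ℂˣ, ‖(lam : ℂ)‖ ≠ 1 ∧
    ((∃ N : ℕ, IsInducedBy (EuclideanSpace ℂ (Fin N)) lam g) ∨
      IsInducedBy (lp (fun _ : ℕ => ℂ) 2) lam g)

/-- `g` can be approximated by Hopf-induced metrics in the `C^k`-topology. -/
def IsApproximable {E : Type*} [NormedAddCommGroup E] [NormedSpace ℂ E] {A : E ≃L[ℂ] E}
    (k : ℕ∞) (g : HermitianMetric A) : Prop :=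
  ∃ gs : ℕ → HermitianMetric A, (∀ m, IsHopfInduced (gs m)) ∧ TendstoCk k gs g

end Classical

/-! ### Diagonal Hopf surfaces -/

section Surfaces

/-- The automorphism `(z₁, z₂) ↦ (α z₁, β z₂)` of `ℂ²`; the diagonal Hopf surface is
`HopfManifold (diagAut α β)`. -/
def diagAut (α β : ℂˣ) : EuclideanSpace ℂ (Fin 2) ≃L[ℂ] EuclideanSpace ℂ (Fin 2) :=
  LinearEquiv.toContinuousLinearEquiv
    { toFun := fun z => !₂[(α : ℂ) * z 0, (β : ℂ) * z 1]
      invFun := fun z => !₂[(α : ℂ)⁻¹ * z 0, (β : ℂ)⁻¹ * z 1]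
      map_add' := by intro z w; ext i; fin_cases i <;> simp [mul_add]
      map_smul' := by intro c z; ext i; fin_cases i <;> simp <;> ring
      left_inv := by intro z; ext i; fin_cases i <;> simp
      right_inv := by intro z; ext i; fin_cases i <;> simp }

/-- The Gauduchon-Ornea potential: the positive function `Φ` on `ℂ² \ {0}` with
`|z₁|² Φ^(-2 log|α| / (log|α| + log|β|)) + |z₂|² Φ^(-2 log|β| / (log|α| + log|β|)) = 1`. -/
def IsGauduchonOrneaPotential (α β : ℂˣ) (Φ : EuclideanSpace ℂ (Fin 2) → ℝ) : Prop :=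
  ∀ z, z ≠ 0 → 0 < Φ z ∧
    ‖z 0‖ ^ 2 * Φ z ^ (-(2 * Real.log ‖(α : ℂ)‖
        / (Real.log ‖(α : ℂ)‖ + Real.log ‖(β : ℂ)‖)))
      + ‖z 1‖ ^ 2 * Φ z ^ (-(2 * Real.log ‖(β : ℂ)‖
        / (Real.log ‖(α : ℂ)‖ + Real.log ‖(β : ℂ)‖))) = 1

/-- The symmetric tensor with associated `(1,1)`-form `dd^c Φ = (i/2) ∂∂̄ Φ`; for `Φ = ‖z‖²` it
is the flat metric `Re ⟪X, Y⟫`. -/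
def ddcTensor {E : Type*} [NormedAddCommGroup E] [NormedSpace ℂ E] (Φ : E → ℝ) (z X Y : E) : ℝ :=
  (1 / 4) * (fderiv ℝ (fderiv ℝ Φ) z X Y
    + fderiv ℝ (fderiv ℝ Φ) z (Complex.I • X) (Complex.I • Y))

/-- `g` is the Gauduchon-Ornea metric, with associated form `Φ⁻¹ dd^c Φ`, where `Φ` is the
Gauduchon-Ornea potential. -/
def IsGauduchonOrnea (α β : ℂˣ) (g : HermitianMetric (diagAut α β)) : Prop :=
  ∃ Φ : EuclideanSpace ℂ (Fin 2) → ℝ, IsGauduchonOrneaPotential α β Φ ∧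
    ∀ z, z ≠ 0 → ∀ X Y, g.toFun z X Y = (Φ z)⁻¹ * ddcTensor Φ z X Y

end Surfaces

end HopfLcK

end

/-!
For `|α| = |β|` the Gauduchon-Ornea potential is `‖z‖²`, and a direct computation shows that
`‖z‖⁻² g₀` has the parallel Lee form `-d log ‖z‖²`.

The surface carries no Hopf-induced metric at all. The chart `(u, w) ↦ eᵘ (1, w)` turns the deck
transformation into `(u, w) ↦ (u + log α, ρ w)`, where `ρ = β / α` has absolute value one, and
forgets translations of `u` by `2πi`. A holomorphic map to a classical Hopf manifold lifts along the
chart to a map `Ψ` which is multiplied by powers of `λ` under both operations. Since rotations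
preserve discs, `Ψ` becomes bounded on each product of the `u`-plane with a disc after division by
a character `e^{cu}`, so that `Ψ (u, w) = e^{cu} Ψ (0, w)` by Liouville's theorem. It follows that
`Ψ (0, ρ w) = Ψ (0, w)`, and as `ρ ≠ 1`, the derivative of `w ↦ Ψ (0, w)` vanishes at zero, while a
map which induces a metric is an immersion.
-/

namespace HopfLcK

open Topology Metric

section Quasiperiodic

/-- The translations `a` which leave the family `N` invariant up to a permutation, not necessarily
continuous, of its parameters. -/
def twistedPeriods {W X Y : Type*} [AddCommGroup W] (N : W → X → Y) : AddSubgroup W where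
  carrier := {a | ∃ T : Equiv.Perm X, ∀ u x, N (u + a) (T x) = N u x}
  zero_mem' := ⟨1, by simp⟩
  add_mem' := by
    rintro a b ⟨S, hS⟩ ⟨T, hT⟩
    exact ⟨T * S, fun u x => by rw [← add_assoc, Equiv.Perm.mul_apply, hT, hS]⟩
  neg_mem' := by
    rintro a ⟨T, hT⟩
    exact ⟨T.symm, fun u x => by rw [← hT, neg_add_cancel_right, T.apply_symm_apply]⟩

variable {ι W X : Type*} [Finite ι] [TopologicalSpace X] [CompactSpace X]

theorem isBounded_range_of_mem_twistedPeriods [NormedAddCommGroup W] [NormedSpace ℝ W]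
    {Y : Type*} [PseudoMetricSpace Y] {N : W → X → Y} (hN : Continuous N.uncurry)
    (b : Module.Basis ι ℝ W) (hb : ∀ i, b i ∈ twistedPeriods N) :
    Bornology.IsBounded (Set.range N.uncurry) := by
  cases nonempty_fintype ι
  have : FiniteDimensional ℝ W := b.finiteDimensional_of_finite
  have : ProperSpace W := FiniteDimensional.proper_real W
  have hspan : (Submodule.span ℤ (Set.range b)).toAddSubgroup ≤ twistedPeriods N := by
    rw [Submodule.span_int_eq_addSubgroupClosure, AddSubgroup.closure_le]
    exact Set.range_subset_iff.2 hb
  refine (((isCompact_closedBall (0 : W) (∑ i, ‖b i‖)).prod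
    (isCompact_univ (X := X))).image hN).isBounded.subset ?_
  rintro _ ⟨⟨u, x⟩, rfl⟩
  obtain ⟨T, hT⟩ := hspan (ZSpan.floor b u).2
  refine ⟨(ZSpan.fract b u, T.symm x),
    ⟨mem_closedBall_zero_iff.2 (ZSpan.norm_fract_le b u), Set.mem_univ _⟩, ?_⟩
  have h := hT (ZSpan.fract b u) (T.symm x)
  rw [ZSpan.fract_apply, sub_add_cancel, T.apply_symm_apply] at h
  exact h.symm

variable [NormedAddCommGroup W] [NormedSpace ℂ W] {V : Type*} [NormedAddCommGroup V]
  [NormedSpace ℂ V]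

/- Some complex character `exp c` has multipliers of the same absolute value as those of `Ψ`;
after division by it, Liouville's theorem applies. -/
theorem exists_eq_exp_smul_of_quasiperiodic {Ψ : W → X → V} (hcont : Continuous Ψ.uncurry)
    (hdiff : ∀ x, Differentiable ℂ fun u => Ψ u x) (b : Module.Basis ι ℝ W)
    (hb : ∀ i, ∃ μ : ℂ, μ ≠ 0 ∧ ∃ T : Equiv.Perm X, ∀ u x, Ψ (u + b i) (T x) = μ • Ψ u x) :
    ∃ c : W →L[ℂ] ℂ, ∀ u x, Ψ u x = Complex.exp (c u) • Ψ 0 x := by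
  have : FiniteDimensional ℝ W := b.finiteDimensional_of_finite
  choose μ hμ T hT using hb
  set ℓ : W →L[ℝ] ℝ := (b.constr ℝ fun i => Real.log ‖μ i‖).toContinuousLinearMap
  set c : W →L[ℂ] ℂ := StrongDual.extendRCLike (𝕜 := ℂ) ℓ
  have hc (i) : ‖Complex.exp (-c (b i))‖ * ‖μ i‖ = 1 := by
    have hre : (c (b i)).re = Real.log ‖μ i‖ :=
      (StrongDual.re_extendRCLike_apply (𝕜 := ℂ) ℓ (b i)).trans (by simp [ℓ])
    rw [Complex.norm_exp, Complex.neg_re, hre, Real.exp_neg,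
      Real.exp_log (norm_pos_iff.2 (hμ i)), inv_mul_cancel₀ (norm_ne_zero_iff.2 (hμ i))]
  set G : W → X → V := fun u x => Complex.exp (-c u) • Ψ u x
  have hG : Continuous G.uncurry :=
    (Complex.continuous_exp.comp (c.continuous.comp continuous_fst).neg).smul hcont
  have hperiod (i) : b i ∈ twistedPeriods fun u x => ‖G u x‖ := by
    refine ⟨T i, fun u x => ?_⟩
    simp only [G, hT, map_add, neg_add, Complex.exp_add, norm_smul, norm_mul]
    linear_combination ‖Complex.exp (-c u)‖ * ‖Ψ u x‖ * hc i
  have hbounded := isBounded_range_of_mem_twistedPeriods hG.norm b hperiod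
  refine ⟨c, fun u x => ?_⟩
  have hconst : G u x = G 0 x := by
    refine Differentiable.apply_eq_apply_of_bounded (f := fun u => G u x)
      ((c.differentiable.neg.cexp).smul (hdiff x)) ?_ u 0
    obtain ⟨C, hC⟩ := isBounded_iff_forall_norm_le.1 hbounded
    refine isBounded_iff_forall_norm_le.2 ⟨C, ?_⟩
    rintro _ ⟨u, rfl⟩
    simpa using hC _ ⟨(u, x), rfl⟩
  simp only [G, map_zero, neg_zero, Complex.exp_zero, one_smul] at hconst
  rw [← hconst, smul_smul, ← Complex.exp_add, add_neg_cancel, Complex.exp_zero, one_smul]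

theorem apply_zero_mul_eq_of_quasiperiodic {Ψ : ℂ × ℂ → V} (hΨ : Differentiable ℂ Ψ)
    (h0 : Ψ 0 ≠ 0) {a ρ μ ν : ℂ} (ha : a.re ≠ 0) (hρ : ‖ρ‖ = 1) (hμ : μ ≠ 0) (hν : ν ≠ 0)
    (hΨμ : ∀ u w, Ψ (u + a, ρ * w) = μ • Ψ (u, w))
    (hΨν : ∀ u w, Ψ (u + 2 * Real.pi * Complex.I, w) = ν • Ψ (u, w)) (w : ℂ) :
    Ψ (0, ρ * w) = Ψ (0, w) := by
  have hli : LinearIndependent ℝ ![a, 2 * Real.pi * Complex.I] := by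
    refine LinearIndependent.pair_iff.2 fun s t hst => ?_
    obtain rfl : s = 0 := by simpa [ha] using congrArg Complex.re hst
    exact ⟨rfl, by simpa [Real.pi_ne_zero] using hst⟩
  let b := basisOfLinearIndependentOfCardEqFinrank hli
    (by rw [Fintype.card_fin, Complex.finrank_real_complex])
  have hρ0 : ρ ≠ 0 := norm_ne_zero_iff.1 (hρ ▸ one_ne_zero)
  let R : Equiv.Perm (closedBall (0 : ℂ) ‖w‖) :=
    (Equiv.mulLeft₀ ρ hρ0).subtypePerm fun v => by simp [hρ]
  obtain ⟨c, hc⟩ := exists_eq_exp_smul_of_quasiperiodic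
    (Ψ := fun u (v : closedBall (0 : ℂ) ‖w‖) => Ψ (u, v))
    (hΨ.continuous.comp (by fun_prop)) (fun v => hΨ.comp (by fun_prop)) b (by
      intro i
      fin_cases i
      · exact ⟨μ, hμ, R, fun u v => by simpa [b, R] using hΨμ u v⟩
      · exact ⟨ν, hν, 1, fun u v => by simpa [b] using hΨν u v⟩)
  have hexp (v : closedBall (0 : ℂ) ‖w‖) : Complex.exp (c a) • Ψ (0, ρ * v) = μ • Ψ (0, v) := by
    rw [← hΨμ, zero_add]
    exact (hc a (R v)).symm
  have hμc : Complex.exp (c a) = μ := by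
    have h := hexp ⟨0, by simp⟩
    rw [mul_zero] at h
    exact smul_left_injective ℂ h0 h
  have h := hexp ⟨w, by simp⟩
  rw [hμc] at h
  exact smul_right_injective V hμ h

end Quasiperiodic

section LocalLifts

variable {E V : Type*} [NormedAddCommGroup E] [NormedSpace ℂ E] [NormedAddCommGroup V]
  [NormedSpace ℂ V] {A : E ≃L[ℂ] E} {B : V ≃L[ℂ] V} {f : HopfManifold A → HopfManifold B}

theorem HopfManifold.proj_eq_proj_iff {z w : E} {hz : z ≠ 0} {hw : w ≠ 0} :
    proj A z hz = proj A w hw ↔ ∃ n : ℤ, (A ^ n) z = w :=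
  Quotient.eq

theorem HopfManifold.exists_proj_eq (y : HopfManifold A) : ∃ z hz, proj A z hz = y := by
  obtain ⟨⟨z, hz⟩, rfl⟩ := Quotient.exists_rep y
  exact ⟨z, hz, rfl⟩

namespace IsLocalLift

variable {U : Set E} {F : E → V}

theorem differentiableAt (h : IsLocalLift f U F) {z : E} (hz : z ∈ U) :
    DifferentiableAt ℂ F z :=
  h.differentiableOn.differentiableAt (h.isOpen.mem_nhds hz)

theorem zpow_comp (h : IsLocalLift f U F) (n : ℤ) :
    IsLocalLift f U fun z => (B ^ n) (F z) where
  isOpen := h.isOpen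
  differentiableOn := (B ^ n).differentiable.comp_differentiableOn h.differentiableOn
  lift z hz := by
    obtain ⟨hz0, hF0, hlift⟩ := h.lift z hz
    exact ⟨hz0, (B ^ n).map_ne_zero_iff.2 hF0,
      hlift.trans (HopfManifold.proj_eq_proj_iff.2 ⟨n, rfl⟩)⟩

end IsLocalLift

theorem IsPullback.eq_zero_of_fderiv_eq_zero {h : HermitianMetric B} {g : HermitianMetric A}
    (hpull : IsPullback f h g) {U : Set E} {F : E → V} (hF : IsLocalLift f U F) {z : E}
    (hz : z ∈ U) {X : E} (hX : fderiv ℂ F z X = 0) : X = 0 := by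
  by_contra hX0
  have hpos := g.pos z (hF.lift z hz).1 X hX0
  rw [hpull U F hF z hz, hX, map_zero] at hpos
  exact lt_irrefl _ hpos

/-- `Ψ` is a lift of `f` along `p`: near each point it is `F ∘ p` for a holomorphic local lift `F`
of `f`, so that it is holomorphic as soon as `p` is. -/
def IsLiftAlong {W : Type*} [TopologicalSpace W] (f : HopfManifold A → HopfManifold B)
    (p : W → E) (Ψ : W → V) : Prop :=
  ∀ x, ∃ (U : Set E) (F : E → V), p x ∈ U ∧ IsLocalLift f U F ∧ Ψ =ᶠ[𝓝 x] F ∘ p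

namespace IsLiftAlong

theorem map_proj {W : Type*} [TopologicalSpace W] {p : W → E} {Ψ : W → V}
    (h : IsLiftAlong f p Ψ) (x : W) : ∃ (hp : p x ≠ 0) (hΨ : Ψ x ≠ 0),
      f (HopfManifold.proj A (p x) hp) = HopfManifold.proj B (Ψ x) hΨ := by
  obtain ⟨U, F, hU, hF, he⟩ := h x
  rw [he.self_of_nhds]
  exact hF.lift _ hU

theorem comp {W W' : Type*} [TopologicalSpace W] [TopologicalSpace W'] {p : W → E} {Ψ : W → V}
    (h : IsLiftAlong f p Ψ) {j : W' → W} (hj : Continuous j) : IsLiftAlong f (p ∘ j) (Ψ ∘ j) := by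
  intro x
  obtain ⟨U, F, hU, hF, he⟩ := h (j x)
  exact ⟨U, F, hU, hF, he.comp_tendsto (hj.tendsto x)⟩

theorem continuous {W : Type*} [TopologicalSpace W] {p : W → E} {Ψ : W → V}
    (h : IsLiftAlong f p Ψ) (hp : Continuous p) : Continuous Ψ := by
  refine continuous_iff_continuousAt.2 fun x => ?_
  obtain ⟨U, F, hU, hF, he⟩ := h x
  exact ((hF.differentiableAt hU).continuousAt.comp hp.continuousAt).congr he.symm

theorem differentiable {W : Type*} [NormedAddCommGroup W] [NormedSpace ℂ W] {p : W → E}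
    {Ψ : W → V} (h : IsLiftAlong f p Ψ) (hp : Differentiable ℂ p) : Differentiable ℂ Ψ := by
  intro x
  obtain ⟨U, F, hU, hF, he⟩ := h x
  exact ((hF.differentiableAt hU).comp x (hp x)).congr_of_eventuallyEq he

theorem deriv_ne_zero {q : ℂ → E} {φ : ℂ → V} (h : IsLiftAlong f q φ) {η : HermitianMetric B}
    {g : HermitianMetric A} (hpull : IsPullback f η g) {w : ℂ} {v : E} (hq : HasDerivAt q v w)
    (hv : v ≠ 0) : deriv φ w ≠ 0 := by
  obtain ⟨U, F, hU, hF, he⟩ := h w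
  rw [he.deriv_eq, ((hF.differentiableAt hU).hasFDerivAt.comp_hasDerivAt w hq).deriv]
  exact fun h0 => hv (hpull.eq_zero_of_fderiv_eq_zero hF hU h0)

end IsLiftAlong

end LocalLifts

section ClassicalTarget

variable {V : Type*} [NormedAddCommGroup V] [NormedSpace ℂ V] {lam : ℂˣ}

theorem scalarAut_zpow_apply (n : ℤ) (v : V) : (scalarAut V lam ^ n) v = (lam : ℂ) ^ n • v := by
  rw [scalarAut, ← map_zpow, ContinuousLinearEquiv.smulLeft_apply_apply, Units.smul_def,
    Units.val_zpow_eq_zpow_val]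

theorem log_norm_scalarAut_zpow (n : ℤ) {v : V} (hv : v ≠ 0) :
    Real.log ‖(scalarAut V lam ^ n) v‖ = n * Real.log ‖(lam : ℂ)‖ + Real.log ‖v‖ := by
  rw [scalarAut_zpow_apply, norm_smul, norm_zpow, Real.log_mul, Real.log_zpow]
  · exact zpow_ne_zero _ (norm_ne_zero_iff.2 lam.ne_zero)
  · exact norm_ne_zero_iff.2 hv

theorem log_norm_coe_ne_zero (hlam : ‖(lam : ℂ)‖ ≠ 1) : Real.log ‖(lam : ℂ)‖ ≠ 0 :=
  Real.log_ne_zero_of_pos_of_ne_one (norm_pos_iff.2 lam.ne_zero) hlam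

theorem eq_of_abs_log_norm_sub_lt {v w : V} {hv : v ≠ 0} {hw : w ≠ 0}
    (h : HopfManifold.proj (scalarAut V lam) v hv = HopfManifold.proj (scalarAut V lam) w hw)
    (hlt : |Real.log ‖w‖ - Real.log ‖v‖| < |Real.log ‖(lam : ℂ)‖|) : v = w := by
  obtain ⟨n, rfl⟩ := HopfManifold.proj_eq_proj_iff.1 h
  rw [log_norm_scalarAut_zpow n hv, add_sub_cancel_right, abs_mul] at hlt
  have hn : n = 0 := by
    by_contra hn
    have h1 : (1 : ℝ) ≤ |(n : ℝ)| := by exact_mod_cast Int.one_le_abs hn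
    exact hlt.not_ge (le_mul_of_one_le_left (abs_nonneg _) h1)
  rw [hn, zpow_zero]
  rfl

/-- The logarithm of the norm, which on the classical Hopf manifold is defined up to multiples of
`log |λ|`. -/
noncomputable def logNorm (lam : ℂˣ) :
    HopfManifold (scalarAut V lam) → AddCircle (Real.log ‖(lam : ℂ)‖) :=
  Quotient.lift (fun v => ((Real.log ‖(v : V)‖ : ℝ) : AddCircle (Real.log ‖(lam : ℂ)‖))) (by
    rintro ⟨v, hv⟩ ⟨_, hw⟩ ⟨n, rfl⟩
    dsimp only
    rw [log_norm_scalarAut_zpow n hv, AddCircle.coe_add, ← zsmul_eq_mul, AddCircle.coe_zsmul,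
      AddCircle.coe_period, smul_zero, zero_add])

theorem logNorm_proj {v : V} (hv : v ≠ 0) :
    logNorm lam (HopfManifold.proj (scalarAut V lam) v hv) = (Real.log ‖v‖ : ℝ) := rfl

theorem exists_proj_eq_and_log_norm_eq {y : HopfManifold (scalarAut V lam)} {t : ℝ}
    (ht : (t : AddCircle (Real.log ‖(lam : ℂ)‖)) = logNorm lam y) :
    ∃ v hv, HopfManifold.proj (scalarAut V lam) v hv = y ∧ Real.log ‖v‖ = t := by
  obtain ⟨v, hv, rfl⟩ := HopfManifold.exists_proj_eq y
  rw [logNorm_proj, ← sub_eq_zero, ← AddCircle.coe_sub, AddCircle.coe_eq_zero_iff] at ht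
  obtain ⟨n, hn⟩ := ht
  refine ⟨(scalarAut V lam ^ n) v, (scalarAut V lam ^ n).map_ne_zero_iff.2 hv,
    (HopfManifold.proj_eq_proj_iff.2 ⟨n, rfl⟩).symm, ?_⟩
  rw [log_norm_scalarAut_zpow n hv, ← zsmul_eq_mul, hn, sub_add_cancel]

theorem exists_zpow_smul_eq {W : Type*} [TopologicalSpace W] [PreconnectedSpace W]
    (hlam : ‖(lam : ℂ)‖ ≠ 1) {Ψ Ψ' : W → V} (hΨ : Continuous Ψ) (hΨ' : Continuous Ψ')
    (h0 : ∀ x, Ψ x ≠ 0) (h : ∀ x, ∃ n : ℤ, (scalarAut V lam ^ n) (Ψ x) = Ψ' x) :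
    ∃ n : ℤ, ∀ x, Ψ' x = (lam : ℂ) ^ n • Ψ x := by
  choose n hn using h
  have h0' (x : W) : Ψ' x ≠ 0 := hn x ▸ (scalarAut V lam ^ n x).map_ne_zero_iff.2 (h0 x)
  have hlog : (fun x => (n x : ℝ)) = fun x =>
      (Real.log ‖Ψ' x‖ - Real.log ‖Ψ x‖) / Real.log ‖(lam : ℂ)‖ := by
    funext x
    rw [← hn, log_norm_scalarAut_zpow _ (h0 x), add_sub_cancel_right,
      mul_div_cancel_right₀ _ (log_norm_coe_ne_zero hlam)]
  have hcont : Continuous n := by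
    refine Int.isClosedEmbedding_coe_real.isInducing.continuous_iff.2 ?_
    rw [Function.comp_def, hlog]
    exact ((hΨ'.norm.log fun x => norm_ne_zero_iff.2 (h0' x)).sub
      (hΨ.norm.log fun x => norm_ne_zero_iff.2 (h0 x))).div_const _
  rcases isEmpty_or_nonempty W with _ | ⟨⟨x₀⟩⟩
  · exact ⟨0, isEmptyElim⟩
  · refine ⟨n x₀, fun x => ?_⟩
    rw [PreconnectedSpace.constant ‹_› hcont (x := x₀) (y := x), ← scalarAut_zpow_apply, hn]

variable {E : Type*} [NormedAddCommGroup E] [NormedSpace ℂ E] {A : E ≃L[ℂ] E}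
  {f : HopfManifold A → HopfManifold (scalarAut V lam)} {W : Type*} [TopologicalSpace W]
  {p : W → E}

theorem continuous_logNorm_comp (hf : IsHolomorphic f) (hp : Continuous p) (hp0 : ∀ x, p x ≠ 0) :
    Continuous fun x => logNorm lam (f (HopfManifold.proj A (p x) (hp0 x))) := by
  refine continuous_iff_continuousAt.2 fun x => ?_
  obtain ⟨U, F, hU, hF⟩ := hf (p x) (hp0 x)
  obtain ⟨-, hF0, -⟩ := hF.lift _ hU
  have hlog : ContinuousAt (fun y => Real.log ‖F (p y)‖) x :=
    ((hF.differentiableAt hU).continuousAt.comp hp.continuousAt).norm.log (norm_ne_zero_iff.2 hF0)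
  refine ((AddCircle.continuous_mk' _).continuousAt.comp hlog).congr ?_
  filter_upwards [hp.continuousAt.eventually_mem (hF.isOpen.mem_nhds hU)] with y hy
  obtain ⟨_, hFy, h⟩ := hF.lift _ hy
  exact ((congrArg _ h).trans (logNorm_proj hFy)).symm

/- Two determinations of `log ‖Ψ‖` differ by a multiple of `log |λ|`: a continuous one can be chosen
since `W` is simply connected, and it determines the lift. -/
theorem exists_isLiftAlong [SimplyConnectedSpace W] [LocallyPathConnectedSpace W]
    (hlam : ‖(lam : ℂ)‖ ≠ 1) (hf : IsHolomorphic f) (hp : Continuous p) (hp0 : ∀ x, p x ≠ 0) :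
    ∃ Ψ : W → V, IsLiftAlong f p Ψ := by
  obtain ⟨x₀⟩ : Nonempty W := inferInstance
  obtain ⟨t, ht⟩ := QuotientAddGroup.mk_surjective
    (logNorm lam (f (HopfManifold.proj A (p x₀) (hp0 x₀))))
  obtain ⟨L, ⟨-, hL⟩, -⟩ := (AddCircle.isCoveringMap_coe _).existsUnique_continuousMap_lifts
    ⟨_, continuous_logNorm_comp hf hp hp0⟩ x₀ t ht
  choose Ψ hΨ0 hΨ hΨL using fun x => exists_proj_eq_and_log_norm_eq (congrFun hL x)
  refine ⟨Ψ, fun x => ?_⟩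
  obtain ⟨U, F, hU, hF⟩ := hf (p x) (hp0 x)
  obtain ⟨_, _, hFx⟩ := hF.lift _ hU
  obtain ⟨n, hn⟩ := HopfManifold.proj_eq_proj_iff.1 (hFx.symm.trans (hΨ x).symm)
  refine ⟨U, _, hU, hF.zpow_comp n, ?_⟩
  have hG := ((hF.zpow_comp n).differentiableAt hU).continuousAt.comp hp.continuousAt
  have hlog : ContinuousAt (fun y => |Real.log ‖(scalarAut V lam ^ n) (F (p y))‖ - L y|) x :=
    ((hG.norm.log (by simpa [hn] using hΨ0 x)).sub L.continuous.continuousAt).abs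
  have hlt := hlog.eventually_lt_const (u := |Real.log ‖(lam : ℂ)‖|)
    (by simpa [hn, hΨL] using log_norm_coe_ne_zero hlam)
  filter_upwards [hlt, hp.continuousAt.eventually_mem (hF.isOpen.mem_nhds hU)] with y hy hyU
  obtain ⟨_, _, hGy⟩ := (hF.zpow_comp n).lift _ hyU
  exact eq_of_abs_log_norm_sub_lt ((hΨ y).trans hGy) (by rwa [hΨL])

theorem IsLiftAlong.exists_zpow_smul [PreconnectedSpace W] {Ψ : W → V}
    (hlam : ‖(lam : ℂ)‖ ≠ 1) (hΨ : IsLiftAlong f p Ψ) (hp : Continuous p) {T : W → W}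
    (hT : Continuous T) (n : ℤ) (hpT : ∀ x, (A ^ n) (p x) = p (T x)) :
    ∃ k : ℤ, ∀ x, Ψ (T x) = (lam : ℂ) ^ k • Ψ x := by
  have hΨc := hΨ.continuous hp
  refine exists_zpow_smul_eq hlam hΨc (hΨc.comp hT) (fun x => (hΨ.map_proj x).2.1) fun x => ?_
  obtain ⟨hx, _, h⟩ := hΨ.map_proj x
  obtain ⟨hTx, _, h'⟩ := hΨ.map_proj (T x)
  refine HopfManifold.proj_eq_proj_iff.1 (h.symm.trans (Eq.trans ?_ h'))
  exact congrArg f (HopfManifold.proj_eq_proj_iff.2 ⟨n, hpT x⟩)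

end ClassicalTarget

section EigenChart

variable {E : Type*} [NormedAddCommGroup E] [NormedSpace ℂ E]

/-- The parametrization `(u, w) ↦ e^u (e + w v)` of the vectors of the plane spanned by `e` and `v`
which are not multiples of `v`. -/
noncomputable def eigenChart (e v : E) (x : ℂ × ℂ) : E := Complex.exp x.1 • (e + x.2 • v)

theorem differentiable_eigenChart (e v : E) : Differentiable ℂ (eigenChart e v) :=
  differentiable_fst.cexp.smul ((differentiable_snd.smul_const v).const_add e)

theorem hasDerivAt_eigenChart_zero (e v : E) (w : ℂ) :
    HasDerivAt (fun w => eigenChart e v (0, w)) v w := by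
  simpa [eigenChart] using ((hasDerivAt_id w).smul_const v).const_add e

theorem eigenChart_add_two_pi_I (e v : E) (u w : ℂ) :
    eigenChart e v (u + 2 * Real.pi * Complex.I, w) = eigenChart e v (u, w) := by
  rw [eigenChart, eigenChart, Complex.exp_periodic]

variable {e v : E} {A : E ≃L[ℂ] E} {α β : ℂ}

theorem add_smul_ne_zero_of_eigenvectors (hαβ : α ≠ β) (he : A e = α • e) (hv : A v = β • v)
    (he0 : e ≠ 0) (w : ℂ) : e + w • v ≠ 0 := by
  intro h
  have hβ : A e = β • e := by
    rw [eq_neg_of_add_eq_zero_left h, map_neg, map_smul, hv, smul_neg, smul_comm]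
  exact hαβ (smul_left_injective ℂ he0 (he.symm.trans hβ))

theorem eigenChart_ne_zero (hαβ : α ≠ β) (he : A e = α • e) (hv : A v = β • v) (he0 : e ≠ 0)
    (x : ℂ × ℂ) : eigenChart e v x ≠ 0 :=
  smul_ne_zero (Complex.exp_ne_zero _) (add_smul_ne_zero_of_eigenvectors hαβ he hv he0 _)

theorem map_eigenChart (he : A e = α • e) (hv : A v = β • v) (hα : α ≠ 0) (u w : ℂ) :
    A (eigenChart e v (u, w)) = eigenChart e v (u + Complex.log α, β / α * w) := by
  simp only [eigenChart, map_smul, map_add, he, hv, Complex.exp_add, Complex.exp_log hα, smul_add,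
    smul_smul]
  congr 2
  field_simp

variable {V : Type*} [NormedAddCommGroup V] [InnerProductSpace ℂ V] {lam : ℂˣ}

theorem not_isInducedBy_of_eigenvectors (hαβ : α ≠ β) (habs : ‖α‖ = ‖β‖) (hone : ‖α‖ ≠ 1)
    (he : A e = α • e) (hv : A v = β • v) (he0 : e ≠ 0) (hv0 : v ≠ 0) (hlam : ‖(lam : ℂ)‖ ≠ 1)
    (g : HermitianMetric A) : ¬ IsInducedBy V lam g := by
  rintro ⟨f, hf, hpull⟩
  have hα : α ≠ 0 := by
    rintro rfl
    exact hαβ (norm_eq_zero.1 (habs.symm.trans norm_zero)).symm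
  have hlog : (Complex.log α).re ≠ 0 := by
    rw [Complex.log_re]
    exact Real.log_ne_zero_of_pos_of_ne_one (norm_pos_iff.2 hα) hone
  have hρ : ‖β / α‖ = 1 := by rw [norm_div, ← habs, div_self (norm_ne_zero_iff.2 hα)]
  have hp := differentiable_eigenChart e v
  obtain ⟨Ψ, hΨ⟩ := exists_isLiftAlong hlam hf hp.continuous (eigenChart_ne_zero hαβ he hv he0)
  obtain ⟨k, hk⟩ := hΨ.exists_zpow_smul hlam hp.continuous
    (T := fun x => (x.1 + Complex.log α, β / α * x.2)) (by fun_prop) 1 fun x => by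
      rw [zpow_one, map_eigenChart he hv hα]
  obtain ⟨l, hl⟩ := hΨ.exists_zpow_smul hlam hp.continuous
    (T := fun x => (x.1 + 2 * Real.pi * Complex.I, x.2)) (by fun_prop) 0 fun x => by
      rw [zpow_zero, eigenChart_add_two_pi_I]
      rfl
  have hrot := apply_zero_mul_eq_of_quasiperiodic (hΨ.differentiable hp) (hΨ.map_proj 0).2.1 hlog
    hρ (zpow_ne_zero k lam.ne_zero) (zpow_ne_zero l lam.ne_zero) (fun u w => hk (u, w))
    (fun u w => hl (u, w))
  have hderiv := deriv_comp_mul_left (β / α) (fun w => Ψ (0, w)) 0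
  rw [funext hrot, mul_zero] at hderiv
  have hne := (hΨ.comp (Continuous.prodMk_right 0)).deriv_ne_zero hpull
    (hasDerivAt_eigenChart_zero e v 0) hv0
  have hρ1 : β / α = 1 := smul_left_injective ℂ hne (hderiv.symm.trans (one_smul ℂ _).symm)
  exact hαβ ((div_eq_one_iff_eq hα).1 hρ1).symm

theorem not_isHopfInduced_of_eigenvectors (hαβ : α ≠ β) (habs : ‖α‖ = ‖β‖) (hone : ‖α‖ ≠ 1)
    (he : A e = α • e) (hv : A v = β • v) (he0 : e ≠ 0) (hv0 : v ≠ 0) (g : HermitianMetric A) :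
    ¬ IsHopfInduced g := by
  rintro ⟨lam, hlam, ⟨N, h⟩ | h⟩
  · exact not_isInducedBy_of_eigenvectors hαβ habs hone he hv he0 hv0 hlam g h
  · exact not_isInducedBy_of_eigenvectors hαβ habs hone he hv he0 hv0 hlam g h

end EigenChart

section Homothety

variable {E : Type*} [NormedAddCommGroup E] [InnerProductSpace ℂ E]

theorem flatMetric_comm (X Y : E) : flatMetric E X Y = flatMetric E Y X :=
  inner_re_symm (𝕜 := ℂ) X Y

theorem flatMetric_self (X : E) : flatMetric E X X = ‖X‖ ^ 2 :=
  inner_self_eq_norm_sq (𝕜 := ℂ) X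

theorem flatMetric_smul_I (X Y : E) :
    flatMetric E (Complex.I • X) (Complex.I • Y) = flatMetric E X Y := by
  simp [flatMetric_apply, ← mul_assoc]

theorem flatMetric_map_map {A : E ≃L[ℂ] E} {r : ℝ} (hA : ∀ X, ‖A X‖ = r * ‖X‖) (X Y : E) :
    flatMetric E (A X) (A Y) = r ^ 2 * flatMetric E X Y := by
  have polarization (X Y : E) :
      flatMetric E X Y = (‖X + Y‖ ^ 2 - ‖X‖ ^ 2 - ‖Y‖ ^ 2) / 2 := by
    simp only [← flatMetric_self, map_add, add_apply, flatMetric_comm Y X]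
    ring
  rw [polarization, polarization X Y, ← map_add, hA, hA, hA]
  ring

theorem hasFDerivAt_norm_sq (z : E) :
    HasFDerivAt (fun z : E => ‖z‖ ^ 2) ((2 : ℝ) • flatMetric E z) z := by
  let := InnerProductSpace.rclikeToReal ℂ E
  refine (hasStrictFDerivAt_norm_sq z).hasFDerivAt.congr_fderiv ?_
  rw [ofNat_smul_eq_nsmul ℝ]
  rfl

theorem hasFDerivAt_inv_norm_sq {z : E} (hz : z ≠ 0) :
    HasFDerivAt (fun z : E => (‖z‖ ^ 2)⁻¹) ((-2 * ((‖z‖ ^ 2)⁻¹) ^ 2) • flatMetric E z) z := by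
  have hz2 : ‖z‖ ^ 2 ≠ 0 := pow_ne_zero 2 (norm_ne_zero_iff.2 hz)
  refine ((hasDerivAt_inv hz2).comp_hasFDerivAt z (hasFDerivAt_norm_sq z)).congr_fderiv ?_
  rw [smul_smul]
  ring_nf

theorem contDiffOn_inv_norm_sq : ContDiffOn ℝ ∞ (fun z : E => (‖z‖ ^ 2)⁻¹) {0}ᶜ :=
  let := InnerProductSpace.rclikeToReal ℂ E
  (contDiff_norm_sq ℝ).contDiffOn.inv fun _ hz => pow_ne_zero 2 (norm_ne_zero_iff.2 hz)

/-- The metric `‖z‖⁻² g₀` on the linear Hopf manifold of a homothety `A`. -/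
noncomputable def homothetyMetric (A : E ≃L[ℂ] E) (r : ℝ) (hA : ∀ X, ‖A X‖ = r * ‖X‖) :
    HermitianMetric A where
  toFun z := (‖z‖ ^ 2)⁻¹ • flatMetric E
  smooth := contDiffOn_inv_norm_sq.smul contDiffOn_const
  symm := (classicalHopfMetric E 1).symm
  pos := (classicalHopfMetric E 1).pos
  map_I := (classicalHopfMetric E 1).map_I
  invariant z hz X Y := by
    have hr : r ≠ 0 := left_ne_zero_of_mul (hA z ▸ norm_ne_zero_iff.2 (A.map_ne_zero_iff.2 hz))
    simp only [smul_apply, smul_eq_mul, flatMetric_map_map hA, hA]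
    field_simp

variable {A : E ≃L[ℂ] E} {r : ℝ} {hA : ∀ X, ‖A X‖ = r * ‖X‖}

theorem homothetyMetric_apply (z X Y : E) :
    (homothetyMetric A r hA).toFun z X Y = (‖z‖ ^ 2)⁻¹ * flatMetric E X Y := rfl

theorem fderiv_homothetyMetric {z : E} (hz : z ≠ 0) (X Y Z : E) :
    fderiv ℝ (homothetyMetric A r hA).toFun z X Y Z
      = -2 * ((‖z‖ ^ 2)⁻¹) ^ 2 * flatMetric E z X * flatMetric E Y Z := by
  have h : HasFDerivAt (homothetyMetric A r hA).toFun _ z :=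
    (hasFDerivAt_inv_norm_sq hz).smul_const (flatMetric E)
  simp [h.fderiv]

theorem fderiv_fundForm_homothetyMetric {z : E} (hz : z ≠ 0) (X Y Z : E) :
    fderiv ℝ (fundForm (homothetyMetric A r hA) Y Z) z X
      = -2 * ((‖z‖ ^ 2)⁻¹) ^ 2 * flatMetric E z X * flatMetric E (Complex.I • Y) Z := by
  have h : HasFDerivAt (fundForm (homothetyMetric A r hA) Y Z) _ z :=
    (hasFDerivAt_inv_norm_sq hz).mul_const (flatMetric E (Complex.I • Y) Z)
  rw [h.fderiv]
  simp only [smul_apply, smul_eq_mul]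
  ring

/-- The Lee form `-d log ‖z‖²` of `‖z‖⁻² g₀`. -/
noncomputable def homothetyLeeForm (E : Type*) [NormedAddCommGroup E] [InnerProductSpace ℂ E]
    (z : E) : E →L[ℝ] ℝ :=
  (-2 * (‖z‖ ^ 2)⁻¹) • flatMetric E z

theorem homothetyLeeForm_apply (z X : E) :
    homothetyLeeForm E z X = -2 * (‖z‖ ^ 2)⁻¹ * flatMetric E z X := rfl

theorem fderiv_homothetyLeeForm {z : E} (hz : z ≠ 0) (X Y : E) :
    fderiv ℝ (homothetyLeeForm E) z X Y = -2 * (‖z‖ ^ 2)⁻¹ * flatMetric E X Y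
      + 4 * ((‖z‖ ^ 2)⁻¹) ^ 2 * flatMetric E z X * flatMetric E z Y := by
  have h : HasFDerivAt (homothetyLeeForm E) _ z :=
    ((hasFDerivAt_inv_norm_sq hz).const_mul (-2)).smul (flatMetric E).hasFDerivAt
  rw [h.fderiv]
  simp only [add_apply, smul_apply, ContinuousLinearMap.smulRight_apply, smul_eq_mul]
  ring

theorem isLeeForm_homothetyMetric : IsLeeForm (homothetyMetric A r hA) (homothetyLeeForm E) where
  smooth :=
    (contDiffOn_const.mul contDiffOn_inv_norm_sq).smul (flatMetric E).contDiff.contDiffOn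
  invariant z hz X := by
    have h := (homothetyMetric A r hA).invariant z hz z X
    rw [homothetyMetric_apply, homothetyMetric_apply] at h
    rw [homothetyLeeForm_apply, homothetyLeeForm_apply, mul_assoc, h, mul_assoc]
  closed z hz X Y := by
    rw [fderiv_homothetyLeeForm hz, fderiv_homothetyLeeForm hz, flatMetric_comm Y X]
    ring
  lck z hz X Y Z := by
    simp only [fderiv_fundForm_homothetyMetric hz, homothetyLeeForm_apply, fundForm,
      homothetyMetric_apply]
    ring

theorem isParallel_homothetyLeeForm :
    IsParallel (homothetyMetric A r hA) (homothetyLeeForm E) := by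
  intro z hz X Y
  have := norm_ne_zero_iff.2 hz
  -- For `exp (2φ) • g₀`, `∇_X Y = dφ(X) Y + dφ(Y) X - ⟪X, Y⟫ grad φ`; here `φ = -log ‖z‖`.
  refine ⟨-(‖z‖ ^ 2)⁻¹ • (flatMetric E z X • Y + flatMetric E z Y • X - flatMetric E X Y • z),
    fun Z => ?_, ?_⟩
  · simp only [fderiv_homothetyMetric hz, homothetyMetric_apply, map_smul, map_add, map_sub,
      smul_apply, add_apply, sub_apply, smul_eq_mul]
    ring
  · simp only [fderiv_homothetyLeeForm hz, homothetyLeeForm_apply, map_smul, map_add, map_sub,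
      smul_eq_mul, flatMetric_self]
    field_simp
    ring

theorem isVaisman_homothetyMetric : IsVaisman (homothetyMetric A r hA) :=
  ⟨_, isLeeForm_homothetyMetric, isParallel_homothetyLeeForm⟩

theorem ddcTensor_norm_sq (z X Y : E) :
    ddcTensor (fun z : E => ‖z‖ ^ 2) z X Y = flatMetric E X Y := by
  have h : fderiv ℝ (fun z : E => ‖z‖ ^ 2) = ⇑((2 : ℝ) • flatMetric E) :=
    funext fun z => (hasFDerivAt_norm_sq z).fderiv
  rw [ddcTensor, h, ContinuousLinearMap.fderiv]
  simp only [smul_apply, flatMetric_smul_I, smul_eq_mul]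
  ring

end Homothety

section DiagonalHopfSurface

variable {α β : ℂˣ}

theorem norm_diagAut (habs : ‖(α : ℂ)‖ = ‖(β : ℂ)‖) (z : EuclideanSpace ℂ (Fin 2)) :
    ‖diagAut α β z‖ = ‖(α : ℂ)‖ * ‖z‖ := by
  refine (sq_eq_sq₀ (by positivity) (by positivity)).1 ?_
  simp only [mul_pow, EuclideanSpace.norm_sq_eq, Fin.sum_univ_two]
  change ‖(α : ℂ) * z 0‖ ^ 2 + ‖(β : ℂ) * z 1‖ ^ 2 = _
  rw [norm_mul, norm_mul, ← habs]
  ring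

theorem isGauduchonOrneaPotential_norm_sq (habs : ‖(α : ℂ)‖ = ‖(β : ℂ)‖)
    (hone : ‖(α : ℂ)‖ ≠ 1) : IsGauduchonOrneaPotential α β fun z => ‖z‖ ^ 2 := by
  intro z hz
  have hz2 : 0 < ‖z‖ ^ 2 := pow_pos (norm_pos_iff.2 hz) 2
  have hlog := log_norm_coe_ne_zero hone
  have hexp : 2 * Real.log ‖(α : ℂ)‖ / (Real.log ‖(α : ℂ)‖ + Real.log ‖(α : ℂ)‖) = 1 := by
    rw [← two_mul, div_self (mul_ne_zero two_ne_zero hlog)]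
  refine ⟨hz2, ?_⟩
  rw [← habs, hexp, Real.rpow_neg_one, ← add_mul, ← Fin.sum_univ_two fun i => ‖z i‖ ^ 2,
    ← EuclideanSpace.norm_sq_eq, mul_inv_cancel₀ hz2.ne']

theorem isGauduchonOrnea_homothetyMetric (habs : ‖(α : ℂ)‖ = ‖(β : ℂ)‖)
    (hone : ‖(α : ℂ)‖ ≠ 1) :
    IsGauduchonOrnea α β (homothetyMetric (diagAut α β) ‖(α : ℂ)‖ (norm_diagAut habs)) := by
  refine ⟨_, isGauduchonOrneaPotential_norm_sq habs hone, fun z _ X Y => ?_⟩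
  rw [homothetyMetric_apply, ddcTensor_norm_sq]

theorem diagAut_single_zero :
    diagAut α β (EuclideanSpace.single 0 1) = (α : ℂ) • EuclideanSpace.single 0 1 := by
  ext i
  fin_cases i <;> simp [diagAut]

theorem diagAut_single_one :
    diagAut α β (EuclideanSpace.single 1 1) = (β : ℂ) • EuclideanSpace.single 1 1 := by
  ext i
  fin_cases i <;> simp [diagAut]

end DiagonalHopfSurface

end HopfLcK

theorem mainTheorem7_general (α β : ℂˣ) (hne : α ≠ β) (habs : ‖(α : ℂ)‖ = ‖(β : ℂ)‖)
    (hone : ‖(α : ℂ)‖ ≠ 1) :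
    (∃ g : HopfLcK.HermitianMetric (HopfLcK.diagAut α β),
      HopfLcK.IsGauduchonOrnea α β g ∧ HopfLcK.IsVaisman g) ∧
    (∀ g : HopfLcK.HermitianMetric (HopfLcK.diagAut α β), ¬ HopfLcK.IsHopfInduced g) :=
  ⟨⟨_, HopfLcK.isGauduchonOrnea_homothetyMetric habs hone, HopfLcK.isVaisman_homothetyMetric⟩,
    HopfLcK.not_isHopfInduced_of_eigenvectors (fun h => hne (Units.ext h)) habs hone
      HopfLcK.diagAut_single_zero HopfLcK.diagAut_single_one (by simp) (by simp)⟩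

theorem mainTheorem7 (α β : ℂˣ) (hne : α ≠ β) (habs : ‖(α : ℂ)‖ = ‖(β : ℂ)‖)
    (hone : ‖(α : ℂ)‖ ≠ 1) :
    (∃ g : HopfLcK.HermitianMetric (HopfLcK.diagAut α β),
      HopfLcK.IsGauduchonOrnea α β g ∧ HopfLcK.IsVaisman g) ∧
    (∀ g : HopfLcK.HermitianMetric (HopfLcK.diagAut α β), HopfLcK.IsVaisman g →
      ∀ k : ℕ∞, ¬ HopfLcK.IsApproximable k g) :=
  have h := mainTheorem7_general α β hne habs hone
  ⟨h.1, fun _ _ _ ⟨gs, hgs, _⟩ => h.2 (gs 0) (hgs 0)⟩
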